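/- Let $K$ be a commutative ring and $A$ a commutative $K$-algebra. For $A$-modules $P,Q$ and $\Phi\in\mathrm{Hom}_K(P,Q)$ put $(\delta_a\Phi)(p)=\Phi(ap)-a\Phi(p)$; $\Phi$ is a differential operator (DO) of order $\le k$ if $\delta_{a_0}\cdots\delta_{a_k}\Phi=0$ for all $a_0,\dots,a_k\in A$. A biad $(Q,Q^+;S)$ is an $A$-bimodule $(Q,Q^+)$ (two commuting $A$-module structures that agree on $K$) with an $A$-submodule $S\subseteq Q$; an $A$-module $Q$ is identified with the biad $(Q,Q;Q)$. For an $A$-module $P$ let $\mathrm{Diff}_k(P,S\subset Q^+)$ be the set of DO's $P\to Q^+$ of order $\le k$ with values in $S$, with the structures $(a^\bullet\Delta)(p)=a\,\Delta(p)$ (multiplication in $Q$) and $(a^+\Delta)(p)=\Delta(ap)$. Put $$\mathcal P_{(k)}[P](Q,Q^+;S)=\big(\mathrm{Diff}^\bullet_k(P,S\subset Q^+),\ \mathrm{Diff}^+_k(P,S\subset Q^+)\big),$$ $$\mathcal P_{(k)}(Q,Q^+;S)=\big(\mathrm{Diff}^\bullet_k(A,S\subset Q^+),\ \mathrm{Diff}^+_k(A,S\subset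 Q^+);\ \{\Delta:\Delta(1)=0\}\big).$$ For $n\ge 1$ and positive integers $\sigma_1,\dots,\sigma_n$ put $\mathcal P_{\sigma(n)}=\mathcal P_{(\sigma_1)}\circ\cdots\circ\mathcal P_{(\sigma_n)}$ and $\mathcal P_{\sigma(n)}[P]=\mathcal P_{(\sigma_1)}[P]\circ\mathcal P_{(\sigma_2)}\circ\cdots\circ\mathcal P_{(\sigma_n)}$. Let $\mathcal P^\bullet_{\sigma(n)}$ and $\mathcal P^\bullet_{\sigma(n)}[P]$ be the first modules of these bimodules, and $\mathrm D_{\sigma(n)}$ the selected submodule of $\mathcal P_{\sigma(n)}$. Put $\mathcal P^\bullet_{\sigma(0)}[P]=\mathrm{Hom}_A(P,\cdot)$. A full abelian subcategory $\mathfrak D$ of $A$-$\mathbf{Mod}$ is differentially closed if it contains $A$, is closed under $\otimes_A$ and under subobjects, if the functors of differential calculus ($\mathcal P_{(k)}$ and, for $P\in\mathfrak D$, $\mathcal P_{(k)}[P]$, with $k\ge0$, hence also all functors obtained from these by composition and by passing to submodules) preserve it, and if the functors $\mathcal P^\bullet_{\sigma(n)}$, $\mathrm D_{\sigma(n)}$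 and, for $P\in\mathfrak D$, $\mathcal P^\bullet_{\sigma(n)}[P]$ ($n\ge 1$) are strictly representable in $\mathfrak D$, that is, naturally isomorphic on $\mathfrak D$ to $\mathrm{Hom}_A(H,\cdot)$ for an object $H$ of $\mathfrak D$. It is smooth if the object that represents $\mathrm D_{(1)}$ in $\mathfrak D$ is a projective $A$-module of finite type. Let $\mathfrak D$ be differentially closed and smooth, and let $\tau=(\tau_1,\tau_2,\dots)$ be a sequence of positive integers that is regular, that is, $\tau_1\le\tau_2\le\cdots$. For $P\in\mathfrak D$ let $\mathrm{Hol}^{\tau(0)}[P]=P$ and, for $n\ge1$, let $\mathrm{Hol}^{\tau(n)}[P]$ be the object of $\mathfrak D$ that represents $\mathcal P^\bullet_{\tau(n)}[P]$. Let $\delta_{\tau(n+1)}:\mathrm{Hol}^{\tau(n)}[P]\to\mathrm{Hol}^{\tau(n+1)}[P]$ be the universal DO of order $\le\tau_1$ on $P$ if $n=0$ and, if $n\ge1$, the DO $h\mapsto f(h)(1)$. Here $f:\mathrm{Hol}^{\tau(n)}[P]\to\mathrm{Diff}^+_{\tau_{n+1}}(A,\mathrm{Hol}^{\tau(n+1)}[P])$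 is the $A$-linear map that corresponds to the image of the universal element of $\mathcal P^\bullet_{\tau(n+1)}[P](\mathrm{Hol}^{\tau(n+1)}[P])$ under the inclusion $\mathcal P_{\tau(n+1)}[P](Q)\subseteq\mathcal P_{\tau(n)}[P](\mathrm{Diff}^{+}_{\tau_{n+1}}(A,Q))$. For $Q\in\mathfrak D$ and $\Delta\in\mathcal P^\bullet_{\tau(n)}[P](Q)$ define $\varphi_{\tau(n+1)}(\Delta)$ to be $\Delta$ if $n=0$ and, if $n\ge 1$, by $$\varphi_{\tau(n+1)}(\Delta)(p)(a_1)\cdots(a_n)=a_n\,\Delta(p)(a_1)\cdots(a_{n-1})+\sum_{k=1}^{n-1}(-1)^{n-k}\Delta(p)(a_1)\cdots(a_ka_{k+1})\cdots(a_n)+(-1)^n\Delta(a_1p)(a_2)\cdots(a_n).$$ Then for every $P\in\mathfrak D$ and $n\ge0$ there is exactly one $A$-linear map $\varphi^{\tau(n+1)}(P):\mathrm{Hol}^{\tau(n+1)}[P]\to\mathrm{Hol}^{\tau(n)}[P]$ that represents $\varphi_{\tau(n+1)}:\mathcal P^\bullet_{\tau(n)}[P]\to\mathcal P^\bullet_{\tau(n+1)}[P]$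 on $\mathfrak D$. The maps $\delta_{\tau(n+1)}$ are DO's of order $\le\tau_{n+1}$ and form a complex $\mathbf{Hol}^\tau(P)$: $$0\to P\to\mathrm{Hol}^{\tau(1)}[P]\to\mathrm{Hol}^{\tau(2)}[P]\to\cdots,$$ and the maps $\varphi^{\tau(n)}(P)$ (with $\varphi^{\tau(0)}(P)=0$) form a contracting homotopy of it: $$\varphi^{\tau(1)}\circ\delta_{\tau(1)}=\mathrm{id}_P,\qquad \varphi^{\tau(n+1)}\circ\delta_{\tau(n+1)}+\delta_{\tau(n)}\circ\varphi^{\tau(n)}=\mathrm{id}_{\mathrm{Hol}^{\tau(n)}[P]}\quad(n\ge1).$$ Both $\delta$ and $\varphi$ are natural in $P\in\mathfrak D$: they commute with the $A$-linear maps $\mathrm{Hol}^{\tau(n)}[P]\to\mathrm{Hol}^{\tau(n)}[P']$ induced by $A$-linear maps $P\to P'$. In particular the complex $\mathbf{Hol}^\tau(P)$ is acyclic: $\delta_{\tau(1)}$ is injective and $\ker\delta_{\tau(n+1)}=\operatorname{im}\delta_{\tau(n)}$ for $n\ge1$. -/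

import Mathlib

open CategoryTheory

universe u v

namespace HigherDiff

/-! ### Differential operators

All modules are modules over the commutative `K`-algebra `A`, and are regarded as `K`-modules
through `algebraMap K A`. Thus an element of `Hom_K(P, Q)` is an additive map `P →+ Q` that
commutes with the action of the elements `algebraMap K A c`. -/

/-- `(δ_a Φ)(p) = Φ(a p) - a Φ(p)`. -/
def delta {A : Type u} [CommRing A] {P Q : Type u} [AddCommGroup P] [Module A P]
    [AddCommGroup Q] [Module A Q] (a : A) (Φ : P →+ Q) : P →+ Q where
  toFun p := Φ (a • p) - a • Φ p
  map_zero' := by simp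
  map_add' x y := by simp only [smul_add, map_add]; abel

/-- `δ_{a₀} ⋯ δ_{a_s} Φ = 0` for all `a₀, …, a_s` in `A`. -/
def HasOrderLE (A : Type u) [CommRing A] {P Q : Type u} [AddCommGroup P] [Module A P]
    [AddCommGroup Q] [Module A Q] : ℕ → (P →+ Q) → Prop
  | 0, Φ => ∀ a : A, delta a Φ = 0
  | s + 1, Φ => ∀ a : A, HasOrderLE A s (delta a Φ)

/-- `Φ` is a `K`-differential operator of order `≤ s` between the `A`-modules `P` and `Q`. -/
structure IsDiffOp (K : Type v) (A : Type u) [CommRing K] [CommRing A] [Algebra K A]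
    {P Q : Type u} [AddCommGroup P] [Module A P] [AddCommGroup Q] [Module A Q]
    (s : ℕ) (Φ : P →+ Q) : Prop where
  map_algebraMap : ∀ (c : K) (p : P), Φ (algebraMap K A c • p) = algebraMap K A c • Φ p
  order : HasOrderLE A s Φ

section Lemmas

variable {K : Type v} {A : Type u} [CommRing K] [CommRing A] [Algebra K A]
  {P Q R : Type u} [AddCommGroup P] [Module A P] [AddCommGroup Q] [Module A Q]
  [AddCommGroup R] [Module A R]

theorem delta_apply (a : A) (Φ : P →+ Q) (p : P) : delta a Φ p = Φ (a • p) - a • Φ p := rfl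

theorem delta_zero (a : A) : delta a (0 : P →+ Q) = 0 := by
  ext p; simp [delta_apply]

theorem delta_add (a : A) (Φ Ψ : P →+ Q) : delta a (Φ + Ψ) = delta a Φ + delta a Ψ := by
  ext p; simp only [delta_apply, AddMonoidHom.add_apply, smul_add]; abel

theorem delta_neg (a : A) (Φ : P →+ Q) : delta a (-Φ) = -delta a Φ := by
  ext p; simp only [delta_apply, AddMonoidHom.neg_apply, smul_neg]; abel

theorem delta_postcomp (a : A) (f : Q →ₗ[A] R) (Φ : P →+ Q) :
    delta a (f.toAddMonoidHom.comp Φ) = f.toAddMonoidHom.comp (delta a Φ) := by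
  ext p; simp [delta_apply]

theorem delta_precomp (a : A) (f : P →ₗ[A] Q) (Φ : Q →+ R) :
    delta a (Φ.comp f.toAddMonoidHom) = (delta a Φ).comp f.toAddMonoidHom := by
  ext p; simp [delta_apply]

theorem HasOrderLE.zero (s : ℕ) : HasOrderLE A s (0 : P →+ Q) := by
  induction s with
  | zero => intro a; exact delta_zero a
  | succ s ih => intro a; rw [delta_zero]; exact ih

theorem HasOrderLE.add {s : ℕ} : ∀ {Φ Ψ : P →+ Q}, HasOrderLE A s Φ → HasOrderLE A s Ψ →
    HasOrderLE A s (Φ + Ψ) := by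
  induction s with
  | zero => intro Φ Ψ h h' a; rw [delta_add, h a, h' a, add_zero]
  | succ s ih => intro Φ Ψ h h' a; rw [delta_add]; exact ih (h a) (h' a)

theorem HasOrderLE.neg {s : ℕ} : ∀ {Φ : P →+ Q}, HasOrderLE A s Φ → HasOrderLE A s (-Φ) := by
  induction s with
  | zero => intro Φ h a; rw [delta_neg, h a, neg_zero]
  | succ s ih => intro Φ h a; rw [delta_neg]; exact ih (h a)

theorem HasOrderLE.postcomp (f : Q →ₗ[A] R) {s : ℕ} : ∀ {Φ : P →+ Q}, HasOrderLE A s Φ →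
    HasOrderLE A s (f.toAddMonoidHom.comp Φ) := by
  induction s with
  | zero => intro Φ h a; rw [delta_postcomp, h a]; ext p; simp
  | succ s ih => intro Φ h a; rw [delta_postcomp]; exact ih (h a)

theorem HasOrderLE.precomp (f : P →ₗ[A] Q) {s : ℕ} : ∀ {Φ : Q →+ R}, HasOrderLE A s Φ →
    HasOrderLE A s (Φ.comp f.toAddMonoidHom) := by
  induction s with
  | zero => intro Φ h a; rw [delta_precomp, h a]; ext p; simp
  | succ s ih => intro Φ h a; rw [delta_precomp]; exact ih (h a)

theorem IsDiffOp.zero (s : ℕ) : IsDiffOp K A s (0 : P →+ Q) :=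
  ⟨fun c p => by simp, HasOrderLE.zero s⟩

theorem IsDiffOp.add {s : ℕ} {Φ Ψ : P →+ Q} (h : IsDiffOp K A s Φ) (h' : IsDiffOp K A s Ψ) :
    IsDiffOp K A s (Φ + Ψ) :=
  ⟨fun c p => by simp [h.1, h'.1], h.2.add h'.2⟩

theorem IsDiffOp.neg {s : ℕ} {Φ : P →+ Q} (h : IsDiffOp K A s Φ) : IsDiffOp K A s (-Φ) :=
  ⟨fun c p => by simp [h.1], h.2.neg⟩

theorem IsDiffOp.postcomp (f : Q →ₗ[A] R) {s : ℕ} {Φ : P →+ Q} (h : IsDiffOp K A s Φ) :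
    IsDiffOp K A s (f.toAddMonoidHom.comp Φ) :=
  ⟨fun c p => by simp [h.1], h.2.postcomp f⟩

theorem IsDiffOp.precomp (f : P →ₗ[A] Q) {s : ℕ} {Φ : Q →+ R} (h : IsDiffOp K A s Φ) :
    IsDiffOp K A s (Φ.comp f.toAddMonoidHom) :=
  ⟨fun c p => by simp [h.1], h.2.precomp f⟩

end Lemmas

/-! ### Biads -/

/-- A biad `(P, P⁺; S)`: an `A`-bimodule `(P, P⁺)` together with an `A`-submodule `S` of `P`.
The instance `plus` is the module `P⁺`; the multiplication by `a` in `P`, which commutes with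
that of `P⁺`, is `act a`. The two structures agree on `K`. A bimodule is identified with the
biad in which `S` is everything. -/
structure Biad (K : Type v) (A : Type u) [CommRing K] [CommRing A] [Algebra K A] where
  carrier : Type u
  [addCommGroup : AddCommGroup carrier]
  [plus : Module A carrier]
  act : A →+* Module.End A carrier
  act_algebraMap : ∀ (c : K) (x : carrier), act (algebraMap K A c) x = algebraMap K A c • x
  sub : AddSubgroup carrier
  act_mem : ∀ (a : A), ∀ x ∈ sub, act a x ∈ sub

attribute [instance] Biad.addCommGroup Biad.plus

section Biads

variable {K : Type v} {A : Type u} [CommRing K] [CommRing A] [Algebra K A]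

/-- An `A`-linear map `P⁺ → Q⁺` that respects the selected submodules, but need not be linear
for the other module structure. -/
structure PlusHom (X Y : Biad K A) where
  map : X.carrier →ₗ[A] Y.carrier
  map_sub : ∀ x ∈ X.sub, map x ∈ Y.sub

/-- Morphisms of biads. -/
@[ext]
structure BiadHom (X Y : Biad K A) where
  map : X.carrier →ₗ[A] Y.carrier
  map_act : ∀ (a : A) (x : X.carrier), map (X.act a x) = Y.act a (map x)
  map_sub : ∀ x ∈ X.sub, map x ∈ Y.sub

/-- The `PlusHom` underlying a morphism of biads. -/
def BiadHom.toPlusHom {X Y : Biad K A} (f : BiadHom X Y) : PlusHom X Y := ⟨f.map, f.map_sub⟩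

instance : Category (Biad K A) where
  Hom X Y := BiadHom X Y
  id X := ⟨LinearMap.id, fun _ _ => rfl, fun _ h => h⟩
  comp f g := ⟨g.map.comp f.map, fun a x => by simp [f.map_act, g.map_act],
    fun x h => g.map_sub _ (f.map_sub x h)⟩

@[simp] theorem id_map (X : Biad K A) : BiadHom.map (𝟙 X) = LinearMap.id := rfl

@[simp] theorem comp_map {X Y Z : Biad K A} (f : X ⟶ Y) (g : Y ⟶ Z) :
    BiadHom.map (f ≫ g) = (BiadHom.map g).comp (BiadHom.map f) := rfl

@[ext] theorem hom_ext {X Y : Biad K A} {f g : X ⟶ Y}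
    (h : ∀ x, BiadHom.map f x = BiadHom.map g x) : f = g :=
  BiadHom.ext (LinearMap.ext h)

/-- The module `P` of a biad `(P, P⁺; S)`. -/
def Biad.leftObj (X : Biad K A) : ModuleCat.{u} A :=
  @ModuleCat.of A _ X.carrier _ (Module.compHom X.carrier X.act)

/-- The module `P⁺` of a biad `(P, P⁺; S)`. -/
def Biad.plusObj (X : Biad K A) : ModuleCat.{u} A := ModuleCat.of A X.carrier

/-- The submodule `S ⊆ P` of a biad `(P, P⁺; S)`. -/
def Biad.subModule (X : Biad K A) : Submodule A X.leftObj where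
  carrier := {x : X.carrier | x ∈ X.sub}
  add_mem' := X.sub.add_mem
  zero_mem' := X.sub.zero_mem
  smul_mem' a x h := X.act_mem a x h

/-- The module `S` of a biad `(P, P⁺; S)`. -/
def Biad.subObj (X : Biad K A) : ModuleCat.{u} A := ModuleCat.of A X.subModule

/-- A morphism of biads as a linear map between the left modules. -/
def leftMap {X Y : Biad K A} (f : X ⟶ Y) : X.leftObj →ₗ[A] Y.leftObj where
  toAddHom := (BiadHom.map f).toAddHom
  map_smul' a x := BiadHom.map_act f a x

variable (K A)

/-- `p₁ : (P, P⁺; S) ↦ P`. -/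
def leftFunctor : Biad K A ⥤ ModuleCat.{u} A where
  obj X := X.leftObj
  map {X Y} f := @ModuleCat.ofHom A _ X.leftObj Y.leftObj _ _ _ _ (leftMap f)

/-- `p₃ : (P, P⁺; S) ↦ S`. -/
def subFunctor : Biad K A ⥤ ModuleCat.{u} A where
  obj X := X.subObj
  map {X Y} f := ModuleCat.ofHom
    (LinearMap.restrict (leftMap f) (p := X.subModule) (q := Y.subModule)
      (fun x h => BiadHom.map_sub f (show X.carrier from x) h))

/-- An `A`-module `M` as the biad `(M, M; M)`. -/
def ofModule : ModuleCat.{u} A ⥤ Biad K A where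
  obj M :=
    { carrier := M
      act := algebraMap A (Module.End A M)
      act_algebraMap := fun _ _ => rfl
      sub := ⊤
      act_mem := fun _ _ _ => trivial }
  map f := ⟨f.hom, fun a x => f.hom.map_smul a x, fun _ _ => trivial⟩

variable {K A}

/-! ### The functors of differential calculus -/

/-- `Diff_k(P, S ⊂ Q⁺)`: differential operators of order `≤ k` from `P` to `Q⁺` with values
in `S`. -/
def diffSub (k : ℕ) (P : Type u) [AddCommGroup P] [Module A P] (X : Biad K A) :
    AddSubgroup (P →+ X.carrier) where
  carrier := {Δ | IsDiffOp K A k Δ ∧ ∀ p, Δ p ∈ X.sub}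
  add_mem' h h' := ⟨h.1.add h'.1, fun p => X.sub.add_mem (h.2 p) (h'.2 p)⟩
  zero_mem' := ⟨IsDiffOp.zero k, fun _ => X.sub.zero_mem⟩
  neg_mem' h := ⟨h.1.neg, fun p => X.sub.neg_mem (h.2 p)⟩

/-- The structure `(a⁺ Δ)(p) = Δ(a p)`. -/
instance diffPlusModule (k : ℕ) (P : Type u) [AddCommGroup P] [Module A P] (X : Biad K A) :
    Module A (diffSub k P X) where
  smul a Δ := ⟨Δ.1.comp (LinearMap.lsmul A P a).toAddMonoidHom,
    Δ.2.1.precomp (LinearMap.lsmul A P a), fun p => Δ.2.2 (a • p)⟩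
  one_smul Δ := Subtype.ext (AddMonoidHom.ext fun p => congrArg Δ.1 (one_smul A p))
  mul_smul a b Δ := Subtype.ext (AddMonoidHom.ext fun p => congrArg Δ.1
    (by change (a * b) • p = b • a • p; rw [mul_comm, mul_smul]))
  smul_zero _ := rfl
  smul_add _ _ _ := rfl
  add_smul a b Δ := Subtype.ext (AddMonoidHom.ext fun p => by
    change Δ.1 ((a + b) • p) = Δ.1 (a • p) + Δ.1 (b • p)
    rw [add_smul, map_add])
  zero_smul Δ := Subtype.ext (AddMonoidHom.ext fun p => by
    change Δ.1 ((0 : A) • p) = 0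
    rw [zero_smul, map_zero])

/-- Composition with a linear map `Q⁺ → R⁺` that respects the selected submodules. -/
def diffPostcomp (k : ℕ) (P : Type u) [AddCommGroup P] [Module A P] {X Y : Biad K A}
    (f : PlusHom X Y) : diffSub k P X →ₗ[A] diffSub k P Y where
  toFun Δ := ⟨f.map.toAddMonoidHom.comp Δ.1, Δ.2.1.postcomp f.map,
    fun p => f.map_sub _ (Δ.2.2 p)⟩
  map_add' Δ Δ' := Subtype.ext (AddMonoidHom.ext fun p => f.map.map_add (Δ.1 p) (Δ'.1 p))
  map_smul' _ _ := rfl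

/-- The structure `(a• Δ)(p) = a Δ(p)`, with multiplication in `Q`. -/
def diffAct (k : ℕ) (P : Type u) [AddCommGroup P] [Module A P] (X : Biad K A) :
    A →+* Module.End A (diffSub k P X) where
  toFun a := diffPostcomp k P ⟨X.act a, X.act_mem a⟩
  map_one' := by ext Δ p; simp [diffPostcomp]
  map_mul' a b := by ext Δ p; simp [diffPostcomp]
  map_zero' := by ext Δ p; simp [diffPostcomp]
  map_add' a b := by ext Δ p; simp [diffPostcomp]

/-- The bimodule `(Diff•_k(P, S ⊂ Q⁺), Diff⁺_k(P, S ⊂ Q⁺))` attached to a biad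
`(Q, Q⁺; S)`. -/
def relObj (k : ℕ) (P : Type u) [AddCommGroup P] [Module A P] (X : Biad K A) : Biad K A where
  carrier := diffSub k P X
  act := diffAct k P X
  act_algebraMap c Δ := Subtype.ext (AddMonoidHom.ext fun p =>
    (X.act_algebraMap c (Δ.1 p)).trans (Δ.2.1.map_algebraMap c p).symm)
  sub := ⊤
  act_mem _ _ _ := trivial

/-- The biad `(Diff•_k(S ⊂ Q⁺), Diff⁺_k(S ⊂ Q⁺); D_(k)(S ⊂ Q⁺))`, where `Diff_k` is
`Diff_k(A, -)` and `D_(k)` consists of the operators `Δ` with `Δ(1) = 0`. -/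
def absObj (k : ℕ) (X : Biad K A) : Biad K A where
  carrier := diffSub k A X
  act := diffAct k A X
  act_algebraMap := (relObj k A X).act_algebraMap
  sub :=
    { carrier := {Δ | Δ.1 1 = 0}
      add_mem' := fun {Δ Δ'} h h' => by
        change Δ.1 1 + Δ'.1 1 = 0
        rw [show Δ.1 1 = 0 from h, show Δ'.1 1 = 0 from h', add_zero]
      zero_mem' := rfl
      neg_mem' := fun {Δ} h => by
        change -Δ.1 1 = 0
        rw [show Δ.1 1 = 0 from h, neg_zero] }
  act_mem a Δ h := by
    change X.act a (Δ.1 1) = 0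
    rw [show Δ.1 1 = 0 from h, map_zero]

/-- The action of `relObj` on plus-linear maps. -/
def relPlusMap (k : ℕ) (P : Type u) [AddCommGroup P] [Module A P] {X Y : Biad K A}
    (f : PlusHom X Y) : PlusHom (relObj k P X) (relObj k P Y) :=
  ⟨diffPostcomp k P f, fun _ _ => trivial⟩

/-- The action of `absObj` on plus-linear maps. -/
def absPlusMap (k : ℕ) {X Y : Biad K A} (f : PlusHom X Y) :
    PlusHom (absObj k X) (absObj k Y) :=
  ⟨diffPostcomp k A f, fun Δ h => by
    change f.map (Δ.1 1) = 0
    rw [show Δ.1 1 = 0 from h, map_zero]⟩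

/-- The relative functor `P_(k)[P]`. -/
def relOne (k : ℕ) (P : Type u) [AddCommGroup P] [Module A P] : Biad K A ⥤ Biad K A where
  obj X := relObj k P X
  map f := ⟨(relPlusMap k P (BiadHom.toPlusHom f)).map,
    fun a Δ => Subtype.ext (AddMonoidHom.ext fun p => BiadHom.map_act f a (Δ.1 p)),
    (relPlusMap k P (BiadHom.toPlusHom f)).map_sub⟩

/-- The absolute functor `P_(k)`. -/
def absOne (k : ℕ) : Biad K A ⥤ Biad K A where
  obj X := absObj k X
  map f := ⟨(absPlusMap k (BiadHom.toPlusHom f)).map,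
    fun a Δ => Subtype.ext (AddMonoidHom.ext fun p => BiadHom.map_act f a (Δ.1 p)),
    (absPlusMap k (BiadHom.toPlusHom f)).map_sub⟩

/-- The absolute functor `P_(σ₁,…,σₙ) = P_(σ₁) ∘ ⋯ ∘ P_(σₙ)`. The sequence `σ₁, σ₂, …` is
`σ 0, σ 1, …`, here and below. -/
def absFunctor (σ : ℕ → ℕ) : ℕ → (Biad K A ⥤ Biad K A)
  | 0 => 𝟭 _
  | n + 1 => absOne (σ n) ⋙ absFunctor σ n

/-- The relative functor `P_(σ₁,…,σₙ₊₁)[P] = P_(σ₁)[P] ∘ P_(σ₂,…,σₙ₊₁)`. -/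
def relFunctor (σ : ℕ → ℕ) (P : Type u) [AddCommGroup P] [Module A P] (n : ℕ) :
    Biad K A ⥤ Biad K A :=
  absFunctor (fun i => σ (i + 1)) n ⋙ relOne (σ 0) P

/-- The action of `absFunctor` on plus-linear maps. -/
def absFunctorPlusMap (σ : ℕ → ℕ) : ∀ (n : ℕ) {X Y : Biad K A}, PlusHom X Y →
    PlusHom ((absFunctor σ n).obj X) ((absFunctor σ n).obj Y)
  | 0, _, _, f => f
  | n + 1, _, _, f => absFunctorPlusMap σ n (absPlusMap (σ n) f)

/-- The action of `relFunctor` on plus-linear maps. -/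
def relFunctorPlusMap (σ : ℕ → ℕ) (P : Type u) [AddCommGroup P] [Module A P] (n : ℕ)
    {X Y : Biad K A} (f : PlusHom X Y) :
    PlusHom ((relFunctor σ P n).obj X) ((relFunctor σ P n).obj Y) :=
  relPlusMap (σ 0) P (absFunctorPlusMap (fun i => σ (i + 1)) n f)

/-- The value `Δ(a₁)⋯(aₙ)` of an element of `P_(σ₁,…,σₙ)(X)`. The arguments `a₁, a₂, …` are
`a 0, a 1, …`. -/
def absEval (σ : ℕ → ℕ) : ∀ (n : ℕ) {X : Biad K A}, ((absFunctor σ n).obj X).carrier →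
    (ℕ → A) → X.carrier
  | 0, _, x, _ => x
  | n + 1, X, t, a =>
    (show diffSub (σ n) A X from absEval σ n (X := absObj (σ n) X) t a).1 (a n)

/-- The value `Δ(p)(a₁)⋯(aₙ)` of an element of `P_(σ₁,…,σₙ₊₁)[P](X)`. -/
def relEval (σ : ℕ → ℕ) (P : Type u) [AddCommGroup P] [Module A P] (n : ℕ) {X : Biad K A}
    (Δ : ((relFunctor σ P n).obj X).carrier) (p : P) (a : ℕ → A) : X.carrier :=
  absEval (fun i => σ (i + 1)) n
    ((show diffSub (σ 0) P ((absFunctor (fun i => σ (i + 1)) n).obj X) from Δ).1 p) a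

end Biads

/-! ### Differentially closed and smooth subcategories -/

/-- A full subcategory is given by a property `D` of `A`-modules. This is a strict representation
in it of a functor `T`: an object `obj` of it and an isomorphism of `T` with
`Hom_A(obj, -)`. -/
structure StrictRep {A : Type u} [CommRing A] (D : ObjectProperty (ModuleCat.{u} A))
    (T : D.FullSubcategory ⥤ ModuleCat.{u} A) where
  obj : D.FullSubcategory
  iso : T ≅ (linearCoyoneda A D.FullSubcategory).obj (Opposite.op obj)

/-- All three modules of a biad are objects of the subcategory. -/
structure Biad.In {K : Type v} {A : Type u} [CommRing K] [CommRing A] [Algebra K A]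
    (D : ObjectProperty (ModuleCat.{u} A)) (X : Biad K A) : Prop where
  left : D X.leftObj
  plus : D X.plusObj
  sub : D X.subObj

section Closed

variable (K : Type v) {A : Type u} [CommRing K] [CommRing A] [Algebra K A]
  (D : ObjectProperty (ModuleCat.{u} A))

/-- `P•_(σ₁,…,σₙ)` on the subcategory. -/
def absBullet (σ : ℕ → ℕ) (n : ℕ) : D.FullSubcategory ⥤ ModuleCat.{u} A :=
  D.ι ⋙ ofModule K A ⋙ absFunctor σ n ⋙ leftFunctor K A

/-- `D•_(σ₁,…,σₙ)` on the subcategory. -/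
def derBullet (σ : ℕ → ℕ) (n : ℕ) : D.FullSubcategory ⥤ ModuleCat.{u} A :=
  D.ι ⋙ ofModule K A ⋙ absFunctor σ n ⋙ subFunctor K A

/-- `P•_(σ₁,…,σₙ₊₁)[P]` on the subcategory. -/
def relBullet (P : ModuleCat.{u} A) (σ : ℕ → ℕ) (n : ℕ) :
    D.FullSubcategory ⥤ ModuleCat.{u} A :=
  D.ι ⋙ ofModule K A ⋙ relFunctor σ P n ⋙ leftFunctor K A

/-- Differentially closed full subcategories of the category of `A`-modules. By `subobjects`, it
is enough to ask that the functors `P_(k)` and `P_(k)[P]` preserve the subcategory, since every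
other functor of differential calculus is obtained from these by composition and by passing to
submodules. -/
structure IsDifferentiallyClosed : Prop where
  abelian : Nonempty (Abelian D.FullSubcategory)
  abs_mem : ∀ (k : ℕ) (X : Biad K A), X.In D → ((absOne k).obj X).In D
  rel_mem : ∀ (k : ℕ) (P : ModuleCat.{u} A), D P → ∀ X : Biad K A, X.In D →
    ((relOne k P).obj X).In D
  abs_rep : ∀ σ : ℕ → ℕ, (∀ i, 0 < σ i) → ∀ n, 0 < n → Nonempty (StrictRep D (absBullet K D σ n))
  der_rep : ∀ σ : ℕ → ℕ, (∀ i, 0 < σ i) → ∀ n, 0 < n → Nonempty (StrictRep D (derBullet K D σ n))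
  rel_rep : ∀ P : ModuleCat.{u} A, D P → ∀ σ : ℕ → ℕ, (∀ i, 0 < σ i) → ∀ n,
    Nonempty (StrictRep D (relBullet K D P σ n))
  ring_mem : D (ModuleCat.of A A)
  tensor_mem : ∀ P Q : ModuleCat.{u} A, D P → D Q → D (ModuleCat.of A (TensorProduct A P Q))
  subobjects : D.IsClosedUnderSubobjects

/-- The representing object of `D_(1)` in the subcategory is a projective `A`-module of finite
type. -/
def IsSmooth : Prop :=
  ∃ R : StrictRep D (derBullet K D (fun _ => 1) 1),
    Module.Finite A R.obj.obj ∧ Module.Projective A R.obj.obj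

end Closed

/-! ### The Hol-complex -/

section Hol

variable {K : Type v} {A : Type u} [CommRing K] [CommRing A] [Algebra K A]
  {D : ObjectProperty (ModuleCat.{u} A)} (hD : IsDifferentiallyClosed K D)
  {τ : ℕ → ℕ} (hτ : ∀ i, 0 < τ i)

/-- A strict representation in the subcategory of `P•_(τ₁,…,τₙ₊₁)[P]`. -/
noncomputable def holRep (P : D.FullSubcategory) (n : ℕ) :
    StrictRep D (relBullet K D P.obj τ n) :=
  Classical.choice (hD.rel_rep P.obj P.property τ hτ n)

/-- `Hol^{τ(n)}[P]`. -/
noncomputable def Hol (P : D.FullSubcategory) : ℕ → D.FullSubcategory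
  | 0 => P
  | n + 1 => (holRep hD hτ P n).obj

/-- The element of `P_(τ₁,…,τₙ₊₁)[P](Q)` that corresponds to a linear map
`Hol^{τ(n+1)}[P] → Q`. -/
noncomputable def holElem (P : D.FullSubcategory) (n : ℕ) {Q : D.FullSubcategory}
    (f : Hol hD hτ P (n + 1) ⟶ Q) :
    ((relFunctor τ P.obj n).obj ((ofModule K A).obj Q.obj)).carrier :=
  ((holRep hD hτ P n).iso.inv.app Q).hom f

/-- The linear map `Hol^{τ(n+1)}[P] → Q` that corresponds to an element of
`P_(τ₁,…,τₙ₊₁)[P](Q)`. -/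
noncomputable def holDesc (P : D.FullSubcategory) (n : ℕ) {Q : D.FullSubcategory}
    (Δ : ((relFunctor τ P.obj n).obj ((ofModule K A).obj Q.obj)).carrier) :
    Hol hD hτ P (n + 1) ⟶ Q :=
  ((holRep hD hτ P n).iso.hom.app Q).hom Δ

/-- The universal element of `P_(τ₁,…,τₙ₊₁)[P](Hol^{τ(n+1)}[P])`. -/
noncomputable def holUniv (P : D.FullSubcategory) (n : ℕ) :
    ((relFunctor τ P.obj n).obj ((ofModule K A).obj (Hol hD hτ P (n + 1)).obj)).carrier :=
  holElem hD hτ P n (𝟙 _)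

theorem ofModule_in (hD : IsDifferentiallyClosed K D) {Q : ModuleCat.{u} A} (hQ : D Q) : ((ofModule K A).obj Q).In D := by
  have := hD.subobjects
  have hl : D ((ofModule K A).obj Q).leftObj := hQ
  let f : ((ofModule K A).obj Q).subObj ⟶ ((ofModule K A).obj Q).leftObj :=
    ModuleCat.ofHom ((ofModule K A).obj Q).subModule.subtype
  have hm : Mono f := (ModuleCat.mono_iff_injective f).2 Subtype.val_injective
  exact ⟨hl, hQ, D.prop_of_mono f hl⟩

/-- `Diff⁺_k Q`, as an object of the subcategory. -/
def diffPlusObj (k : ℕ) (Q : D.FullSubcategory) : D.FullSubcategory :=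
  ⟨((absOne k).obj ((ofModule K A).obj Q.obj)).plusObj,
    (hD.abs_mem k _ (ofModule_in hD Q.property)).plus⟩

/-- The identity of `Diff_k Q`, as a map from the biad
`(Diff_k Q, Diff⁺_k Q; D_(k)(Q))` to the biad of the module `Diff⁺_k Q`. -/
def diffPlusId (k : ℕ) (Q : D.FullSubcategory) :
    PlusHom ((absOne k).obj ((ofModule K A).obj Q.obj))
      ((ofModule K A).obj (diffPlusObj hD k Q).obj) :=
  ⟨LinearMap.id, fun _ _ => trivial⟩

/-- The differential `δ_{τ(n+1)}[P] : Hol^{τ(n)}[P] → Hol^{τ(n+1)}[P]`. For `n = 0` it is the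
universal operator `P → J^{τ₁}(P)`. For `n > 0`, the inclusion of `P_{τ(n+1)}[P](Q)` into
`P_{τ(n)}[P](Diff⁺_{τ_{n+1}} Q)`, with `Q = Hol^{τ(n+1)}[P]`, sends the universal element to an
element that corresponds to a linear map `f : Hol^{τ(n)}[P] → Diff⁺_{τ_{n+1}} Q`, and
`δ(h) = f(h)(1)`. -/
noncomputable def holDiff (P : D.FullSubcategory) :
    ∀ n : ℕ, (Hol hD hτ P n).obj →+ (Hol hD hτ P (n + 1)).obj
  | 0 => (show diffSub (τ 0) P.obj ((ofModule K A).obj (Hol hD hτ P 1).obj) from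
      holUniv hD hτ P 0).1
  | n + 1 =>
    let Q := Hol hD hτ P (n + 2)
    let f : Hol hD hτ P (n + 1) ⟶ diffPlusObj hD (τ (n + 1)) Q :=
      holDesc hD hτ P n
        ((relFunctorPlusMap τ P.obj n (diffPlusId hD (τ (n + 1)) Q)).map (holUniv hD hτ P (n + 1)))
    { toFun := fun h =>
        (show diffSub (τ (n + 1)) A ((ofModule K A).obj Q.obj) from f.hom.hom h).1 1
      map_zero' := by rw [map_zero]; rfl
      map_add' := fun x y => by rw [map_add]; rfl }

/-- The value `Δ(p)(a₁)⋯(a_{n-1})` of the element `Δ` of `P_{τ(n)}[P](Q)` that corresponds to a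
linear map `f : Hol^{τ(n)}[P] → Q`, where `P_{τ(0)}[P](Q) = Hom_A(P, Q)`. -/
noncomputable def holEval (P : D.FullSubcategory) : ∀ (n : ℕ) {Q : D.FullSubcategory},
    (Hol hD hτ P n ⟶ Q) → P.obj → (ℕ → A) → Q.obj
  | 0, _, f, p, _ => f.hom.hom p
  | n + 1, _, f, p, a => relEval τ P.obj n (holElem hD hτ P n f) p a

/-- The sequence `a₁, …, a_k a_{k+1}, …`, in which the entries number `k` and `k + 1`, counted
from `0`, are replaced by their product. -/
def contract (k : ℕ) (a : ℕ → A) (i : ℕ) : A :=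
  if i < k then a i else if i = k then a k * a (k + 1) else a (i + 1)

/-- The operator `φ_{τ(n+1)}(P) : P_{τ(n)}[P](Q) → P_{τ(n+1)}[P](Q)` on evaluated elements
`F(p, a₁, …, a_{n-1}) = Δ(p)(a₁)⋯(a_{n-1})`. For `n = 0` it is the inclusion of `Hom_A(P, Q)`
into `Diff_{τ₁}(P, Q)`, and for `n > 0` its value at `(p, a₁, …, aₙ)` is
`aₙ Δ(p)(a₁)⋯(a_{n-1}) + ∑_{k=1}^{n-1} (-1)^{n-k} Δ(p)(a₁)⋯(a_k a_{k+1})⋯(aₙ)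
+ (-1)ⁿ Δ(a₁ p)(a₂)⋯(aₙ)`. -/
def homotopyFormula {P Q : ModuleCat.{u} A} :
    ℕ → (P → (ℕ → A) → Q) → P → (ℕ → A) → Q
  | 0, F, p, a => F p a
  | m + 1, F, p, a =>
    a m • F p a + ∑ k ∈ Finset.range m, (-1 : ℤ) ^ (m - k) • F p (contract k a)
      + (-1 : ℤ) ^ (m + 1) • F (a 0 • p) (fun i => a (i + 1))

/-- `ψ : Hol^{τ(n+1)}[P] → Hol^{τ(n)}[P]` is the dual representative of
`φ_{τ(n+1)}(P) : P_{τ(n)}[P] → P_{τ(n+1)}[P]`: if `Δ` in `P_{τ(n)}[P](Q)` corresponds to the linear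
map `f`, then `φ_{τ(n+1)}(P)(Q)(Δ)` corresponds to the composite of `ψ` and `f`. -/
def IsDualHomotopy (P : D.FullSubcategory) (n : ℕ)
    (ψ : Hol hD hτ P (n + 1) ⟶ Hol hD hτ P n) : Prop :=
  ∀ (Q : D.FullSubcategory) (f : Hol hD hτ P n ⟶ Q) (p : P.obj) (a : ℕ → A),
    holEval hD hτ P (n + 1) (ψ ≫ f) p a = homotopyFormula n (holEval hD hτ P n f) p a

/-- The map `P_{τ(n+1)}[P'](Q) → P_{τ(n+1)}[P](Q)` given by composition with `g : P → P'`. -/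
def relPrecomp {P P' : D.FullSubcategory} (g : P ⟶ P') (n : ℕ) {X : Biad K A}
    (Δ : ((relFunctor τ P'.obj n).obj X).carrier) : ((relFunctor τ P.obj n).obj X).carrier :=
  let Δ' : diffSub (τ 0) P'.obj ((absFunctor (fun i => τ (i + 1)) n).obj X) := Δ
  (⟨Δ'.1.comp g.hom.hom.toAddMonoidHom, Δ'.2.1.precomp g.hom.hom, fun p => Δ'.2.2 (g.hom.hom p)⟩ :
    diffSub (τ 0) P.obj ((absFunctor (fun i => τ (i + 1)) n).obj X))

/-- The linear map `Hol^{τ(n)}[P] → Hol^{τ(n)}[P']` induced by `g : P → P'`. -/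
noncomputable def holMap {P P' : D.FullSubcategory} (g : P ⟶ P') :
    ∀ n : ℕ, Hol hD hτ P n ⟶ Hol hD hτ P' n
  | 0 => g
  | n + 1 => holDesc hD hτ P n (relPrecomp g n (holUniv hD hτ P' n))

end Hol

end HigherDiff

open HigherDiff

/-!
The idea is to recognize `Hol^{τ(n+1)}[P]` by a universal property one degree at a time. An element
of `P_{τ(n+2)}[P](Q)` is an element of `P_{τ(n+1)}[P](Diff⁺(A, Q))` whose values, which are operators
`A → Q`, annihilate `1`. Linear maps `Hol^{τ(n+1)}[P] → Diff⁺(A, Q)` are the same as operators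
`Φ : Hol^{τ(n+1)}[P] → Q`, and the condition on the values says that `Φ` vanishes on the values
`u(p)(a₁)⋯(aₙ)` of the universal element. These are themselves differentials, since
`u(p)(a₁)⋯(aₙ₊₁) = δ(aₙ₊₁ u(p)(a₁)⋯(aₙ))` (`univEval_succ_succ`). Hence `δ_{τ(n+2)}` is the universal
differential operator of order `≤ τₙ₊₂` on `Hol^{τ(n+1)}[P]` with `δ_{τ(n+2)} ∘ δ_{τ(n+1)} = 0`
(`exists_factor_succ`, `holDiff_holDiff`, `hol_hom_ext`), and `δ_{τ(1)}` is the universal operator of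
order `≤ τ₁` on `P` (`exists_factor_zero`).

Then the contracting homotopy builds itself: `id_P` factors through `δ_{τ(1)}` as `φ^{τ(1)} ∘ δ_{τ(1)}`,
and, once `φ^{τ(n+1)}` is found, the operator `id - δ_{τ(n+1)} ∘ φ^{τ(n+1)}` has order `≤ τₙ₊₁ ≤ τₙ₊₂`
and vanishes on the image of `δ_{τ(n+1)}`, so that it factors as `φ^{τ(n+2)} ∘ δ_{τ(n+2)}`, which is the
homotopy identity (`holHomotopy_succ`). That this `φ` has the prescribed explicit form is an
induction on the universal values (`holHomotopy_univEval`), and uniqueness and naturality follow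
because linear maps out of `Hol^{τ(n)}[P]` are determined by their effect on these values
(`hol_hom_ext_univEval`). For identities between operators that are not linear, such as `δ ∘ δ = 0`,
one needs that the universal values generate `Hol^{τ(n)}[P]` as a module (`span_univEval`); this holds
because the submodule they generate lies in the subcategory, where its inclusion is an epimorphism.
-/

namespace HigherDiff

/-! ### Orders of differential operators -/

section Order

variable {K : Type v} {A : Type u} [CommRing K] [CommRing A] [Algebra K A]
  {P Q R : Type u} [AddCommGroup P] [Module A P] [AddCommGroup Q] [Module A Q]
  [AddCommGroup R] [Module A R]

theorem HasOrderLE.succ {s : ℕ} : ∀ {Φ : P →+ Q}, HasOrderLE A s Φ → HasOrderLE A (s + 1) Φ := by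
  induction s with
  | zero => intro Φ h a b; rw [h a]; exact delta_zero b
  | succ s ih => intro Φ h a; exact ih (h a)

theorem HasOrderLE.mono {s t : ℕ} (hst : s ≤ t) {Φ : P →+ Q} (h : HasOrderLE A s Φ) :
    HasOrderLE A t Φ := by
  induction hst with
  | refl => exact h
  | step _ ih => exact ih.succ

theorem IsDiffOp.mono {s t : ℕ} (hst : s ≤ t) {Φ : P →+ Q} (h : IsDiffOp K A s Φ) :
    IsDiffOp K A t Φ :=
  ⟨h.1, h.2.mono hst⟩

theorem isDiffOp_of_linearMap (f : P →ₗ[A] Q) (s : ℕ) : IsDiffOp K A s f.toAddMonoidHom :=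
  ⟨fun c p => f.map_smul _ p, HasOrderLE.mono (Nat.zero_le s) fun a => by ext p; simp [delta_apply]⟩

theorem HasOrderLE.of_postcomp {f : Q →ₗ[A] R} (hf : Function.Injective f) {s : ℕ} :
    ∀ {Φ : P →+ Q}, HasOrderLE A s (f.toAddMonoidHom.comp Φ) → HasOrderLE A s Φ := by
  induction s with
  | zero =>
    intro Φ h a
    ext p
    apply hf
    have := DFunLike.congr_fun (h a) p
    rw [delta_postcomp] at this
    simpa using this
  | succ s ih => intro Φ h a; apply ih; rw [← delta_postcomp]; exact h a

theorem IsDiffOp.of_postcomp {f : Q →ₗ[A] R} (hf : Function.Injective f) {s : ℕ}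
    {Φ : P →+ Q} (h : IsDiffOp K A s (f.toAddMonoidHom.comp Φ)) : IsDiffOp K A s Φ :=
  ⟨fun c p => hf (by simpa using h.1 c p), h.2.of_postcomp hf⟩

/-- An additive map `E` into operators `A → Q` with `E(c h)(x) = E(h)(c x)` amounts to the
operator `h ↦ E(h)(1)`, for `E(h)(a) = E(a h)(1)`. This passes the order of the `E(h)` on to it,
because `δ_c` commutes with `E ↦ E(-)(1)`. -/
theorem HasOrderLE.eval_one {s : ℕ} : ∀ {E : P →+ (A →+ Q)},
    (∀ (c : A) (h : P) (x : A), E (c • h) x = E h (c * x)) → (∀ h, HasOrderLE A s (E h)) →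
    HasOrderLE A s ((AddMonoidHom.eval (1 : A)).comp E) := by
  have key : ∀ {E : P →+ (A →+ Q)}, (∀ (c : A) (h : P) (x : A), E (c • h) x = E h (c * x)) →
      ∀ c : A, ∃ E' : P →+ (A →+ Q), (∀ h, E' h = delta c (E h)) ∧
        delta c ((AddMonoidHom.eval (1 : A)).comp E) = (AddMonoidHom.eval (1 : A)).comp E' ∧
        ∀ (b : A) (h : P) (x : A), E' (b • h) x = E' h (b * x) := by
    intro E hE c
    refine ⟨⟨⟨fun h => delta c (E h), by rw [map_zero, delta_zero]⟩,
      fun x y => by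
        change delta c (E (x + y)) = delta c (E x) + delta c (E y)
        rw [map_add, delta_add]⟩, fun h => rfl, ?_, ?_⟩
    · ext h
      simp [delta_apply, hE]
    · intro b h x
      simp [delta_apply, hE, mul_left_comm]
  induction s with
  | zero =>
    intro E hE h c
    obtain ⟨E', h₁, h₂, -⟩ := key hE c
    rw [h₂]
    ext x
    simp [h₁, h x c]
  | succ s ih =>
    intro E hE h c
    obtain ⟨E', h₁, h₂, h₃⟩ := key hE c
    rw [h₂]
    exact ih h₃ fun x => by rw [h₁]; exact h x c

end Order

/-! ### Elements of the functors and their values -/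

section Evaluation

variable {K : Type v} {A : Type u} [CommRing K] [CommRing A] [Algebra K A]

theorem absEval_congr (σ : ℕ → ℕ) (n : ℕ) : ∀ {X : Biad K A}
    (x : ((absFunctor σ n).obj X).carrier) {a b : ℕ → A}, (∀ i < n, a i = b i) →
    absEval σ n x a = absEval σ n x b := by
  induction n with
  | zero => intros; rfl
  | succ n ih =>
    intro X x a b h
    simp only [absEval]
    rw [ih (X := absObj (σ n) X) x fun i hi => h i (by omega), h n (by omega)]

/-- An element is determined by its values, a value at the last argument being free to vary because
the inner evaluation involves only the preceding ones. -/
theorem absEval_ext (σ : ℕ → ℕ) (n : ℕ) : ∀ {X : Biad K A}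
    {x y : ((absFunctor σ n).obj X).carrier}, (∀ a, absEval σ n x a = absEval σ n y a) →
    x = y := by
  induction n with
  | zero => intro X x y h; exact h 0
  | succ n ih =>
    intro X x y h
    refine ih (X := absObj (σ n) X) fun a => Subtype.ext (AddMonoidHom.ext fun c => ?_)
    have hc : ∀ i < n, a i = Function.update a n c i := fun i hi =>
      (Function.update_of_ne hi.ne c a).symm
    have := h (Function.update a n c)
    simp only [absEval, Function.update_self] at this
    rw [absEval_congr σ n (X := absObj (σ n) X) x hc, absEval_congr σ n (X := absObj (σ n) X) y hc]
    exact this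

theorem absEval_map (σ : ℕ → ℕ) (n : ℕ) : ∀ {X Y : Biad K A} (f : X ⟶ Y)
    (x : ((absFunctor σ n).obj X).carrier) (a : ℕ → A),
    absEval σ n (BiadHom.map ((absFunctor σ n).map f) x) a = BiadHom.map f (absEval σ n x a) := by
  induction n with
  | zero => intros; rfl
  | succ n ih =>
    intro X Y f x a
    exact DFunLike.congr_fun (congrArg Subtype.val (ih ((absOne (σ n)).map f) x a)) (a n)

theorem absEval_plusMap (σ : ℕ → ℕ) (n : ℕ) : ∀ {X Y : Biad K A} (f : PlusHom X Y)
    (x : ((absFunctor σ n).obj X).carrier) (a : ℕ → A),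
    absEval σ n ((absFunctorPlusMap σ n f).map x) a = f.map (absEval σ n x a) := by
  induction n with
  | zero => intros; rfl
  | succ n ih =>
    intro X Y f x a
    exact DFunLike.congr_fun (congrArg Subtype.val (ih (absPlusMap (σ n) f) x a)) (a n)

theorem absEval_mem_sub (σ : ℕ → ℕ) (n : ℕ) {X : Biad K A}
    {x : ((absFunctor σ n).obj X).carrier} (hx : x ∈ ((absFunctor σ n).obj X).sub) (a : ℕ → A) :
    absEval σ n x a ∈ X.sub := by
  cases n with
  | zero => exact hx
  | succ n => exact (show diffSub (σ n) A X from absEval σ n (X := absObj (σ n) X) x a).2.2 (a n)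

/-- An operator with values in the image of a subgroup under an injective `A`-linear map factors
through that map. -/
theorem exists_diffPostcomp_eq {k : ℕ} {P : Type u} [AddCommGroup P] [Module A P] {X Y : Biad K A}
    {f : PlusHom X Y} (hf : Function.Injective f.map) (Δ : diffSub k P Y)
    (h : ∀ p, ∃ x ∈ X.sub, f.map x = Δ.1 p) : ∃ Δ' : diffSub k P X, diffPostcomp k P f Δ' = Δ := by
  choose Φ hS hΦ using h
  let Φ' : P →+ X.carrier :=
    ⟨⟨Φ, hf (by rw [hΦ, map_zero, map_zero])⟩, fun x y => hf (by simp only [map_add, hΦ])⟩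
  have hΦ' : f.map.toAddMonoidHom.comp Φ' = Δ.1 := AddMonoidHom.ext hΦ
  exact ⟨⟨Φ', IsDiffOp.of_postcomp hf (by rw [hΦ']; exact Δ.2.1), hS⟩, Subtype.ext hΦ'⟩

theorem absPlusMap_injective (k : ℕ) {X Y : Biad K A} {f : PlusHom X Y}
    (hf : Function.Injective f.map) : Function.Injective (absPlusMap k f).map := fun _ _ h =>
  Subtype.ext (AddMonoidHom.ext fun p =>
    hf (DFunLike.congr_fun (congrArg Subtype.val h) p))

/-- Selected elements lift along an injective map as soon as their values lift to selected ones. The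
operators obtained at each stage annihilate `1` again, because the map is injective. -/
theorem exists_absFunctorPlusMap_eq (σ : ℕ → ℕ) (n : ℕ) : ∀ {X Y : Biad K A} {f : PlusHom X Y},
    Function.Injective f.map → ∀ y ∈ ((absFunctor σ n).obj Y).sub,
    (∀ a, ∃ x ∈ X.sub, f.map x = absEval σ n y a) →
    ∃ x ∈ ((absFunctor σ n).obj X).sub, (absFunctorPlusMap σ n f).map x = y := by
  induction n with
  | zero => intro X Y f hf y hy h; exact h 0
  | succ n ih =>
    intro X Y f hf y hy h
    refine ih (X := absObj (σ n) X) (Y := absObj (σ n) Y) (f := absPlusMap (σ n) f)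
      (absPlusMap_injective _ hf) y hy fun a => ?_
    have h1 := absEval_mem_sub σ n (X := absObj (σ n) Y) hy a
    obtain ⟨x, hx⟩ := exists_diffPostcomp_eq hf
      (show diffSub (σ n) A Y from absEval σ n (X := absObj (σ n) Y) y a) fun c => by
        have hc : ∀ i < n, a i = Function.update a n c i := fun i hi =>
          (Function.update_of_ne hi.ne c a).symm
        have := h (Function.update a n c)
        simp only [absEval, Function.update_self] at this
        rw [← absEval_congr σ n (X := absObj (σ n) Y) y hc] at this
        exact this
    refine ⟨x, hf ?_, hx⟩
    rw [map_zero]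
    exact (DFunLike.congr_fun (congrArg Subtype.val hx) 1).trans h1

variable (σ : ℕ → ℕ) {P : Type u} [AddCommGroup P] [Module A P] (n : ℕ)

theorem relEval_congr {X : Biad K A} (Δ : ((relFunctor σ P n).obj X).carrier) (p : P)
    {a b : ℕ → A} (h : ∀ i < n, a i = b i) : relEval σ P n Δ p a = relEval σ P n Δ p b :=
  absEval_congr _ n _ h

theorem relEval_ext {X : Biad K A} {Δ Δ' : ((relFunctor σ P n).obj X).carrier}
    (h : ∀ p a, relEval σ P n Δ p a = relEval σ P n Δ' p a) : Δ = Δ' :=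
  Subtype.ext (AddMonoidHom.ext fun p => absEval_ext _ n (h p))

theorem relEval_map {X Y : Biad K A} (f : X ⟶ Y) (Δ : ((relFunctor σ P n).obj X).carrier) (p : P)
    (a : ℕ → A) : relEval σ P n (BiadHom.map ((relFunctor σ P n).map f) Δ) p a =
      BiadHom.map f (relEval σ P n Δ p a) :=
  absEval_map _ n f _ a

theorem relEval_plusMap {X Y : Biad K A} (f : PlusHom X Y)
    (Δ : ((relFunctor σ P n).obj X).carrier) (p : P) (a : ℕ → A) :
    relEval σ P n ((relFunctorPlusMap σ P n f).map Δ) p a = f.map (relEval σ P n Δ p a) :=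
  absEval_plusMap _ n f _ a

theorem relEval_mem_sub {X : Biad K A} (Δ : ((relFunctor σ P n).obj X).carrier) (p : P)
    (a : ℕ → A) : relEval σ P n Δ p a ∈ X.sub :=
  absEval_mem_sub _ n ((show diffSub (σ 0) P
    ((absFunctor (fun i => σ (i + 1)) n).obj X) from Δ).2.2 p) a

/-- An element of `P_{σ(n+1)}[P](Y)` comes from `P_{σ(n+1)}[P](X)` along an injective `A`-linear map
`X⁺ → Y⁺` as soon as all its values come from the selected submodule of `X`. -/
theorem exists_relFunctorPlusMap_eq {X Y : Biad K A} {f : PlusHom X Y}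
    (hf : Function.Injective f.map) (Δ : ((relFunctor σ P n).obj Y).carrier)
    (h : ∀ p a, ∃ x ∈ X.sub, f.map x = relEval σ P n Δ p a) :
    ∃ Δ', (relFunctorPlusMap σ P n f).map Δ' = Δ := by
  have hinj : Function.Injective (absFunctorPlusMap (fun i => σ (i + 1)) n f).map := by
    intro x y hxy
    refine absEval_ext _ n fun a => hf ?_
    rw [← absEval_plusMap, ← absEval_plusMap, hxy]
  exact exists_diffPostcomp_eq hinj _ fun p =>
    exists_absFunctorPlusMap_eq _ n hf _ ((show diffSub (σ 0) P
      ((absFunctor (fun i => σ (i + 1)) n).obj Y) from Δ).2.2 p) (h p)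

end Evaluation

/-! ### The universal values -/

section Hol

variable {K : Type v} {A : Type u} [CommRing K] [CommRing A] [Algebra K A]
  {D : ObjectProperty (ModuleCat.{u} A)} (hD : IsDifferentiallyClosed K D)
  {τ : ℕ → ℕ} (hτ : ∀ i, 0 < τ i) (P : D.FullSubcategory) (n : ℕ)

theorem holElem_holDesc {Q : D.FullSubcategory}
    (Δ : ((relFunctor τ P.obj n).obj ((ofModule K A).obj Q.obj)).carrier) :
    holElem hD hτ P n (holDesc hD hτ P n Δ) = Δ :=
  congrArg (fun f => f.hom Δ) ((holRep hD hτ P n).iso.hom_inv_id_app Q)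

theorem holDesc_holElem {Q : D.FullSubcategory} (f : Hol hD hτ P (n + 1) ⟶ Q) :
    holDesc hD hτ P n (holElem hD hτ P n f) = f :=
  congrArg (fun g => g.hom f) ((holRep hD hτ P n).iso.inv_hom_id_app Q)

theorem holElem_comp {Q Q' : D.FullSubcategory} (f : Hol hD hτ P (n + 1) ⟶ Q) (g : Q ⟶ Q') :
    holElem hD hτ P n (f ≫ g) =
      BiadHom.map ((relFunctor τ P.obj n).map ((ofModule K A).map g.hom))
        (holElem hD hτ P n f) :=
  congrArg (fun m => m.hom f) ((holRep hD hτ P n).iso.inv.naturality g)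

/-- The values `u(p)(a₁)⋯(aₙ₋₁)` of the universal element of `P_{τ(n)}[P](Hol^{τ(n)}[P])`; for
`n = 0` the value is `p`. -/
noncomputable def univEval (p : P.obj) (a : ℕ → A) : (Hol hD hτ P n).obj :=
  holEval hD hτ P n (𝟙 _) p a

theorem univEval_zero (p : P.obj) (a : ℕ → A) : univEval hD hτ P 0 p a = p := rfl

theorem univEval_congr (p : P.obj) {a b : ℕ → A} (h : ∀ i, i + 1 < n → a i = b i) :
    univEval hD hτ P n p a = univEval hD hτ P n p b := by
  cases n with
  | zero => rfl
  | succ n => exact relEval_congr τ n _ p fun i hi => h i (by omega)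

theorem holEval_eq {Q : D.FullSubcategory} (f : Hol hD hτ P n ⟶ Q) (p : P.obj) (a : ℕ → A) :
    holEval hD hτ P n f p a = f.hom.hom (univEval hD hτ P n p a) := by
  cases n with
  | zero => rfl
  | succ n =>
    have := holElem_comp hD hτ P n (𝟙 _) f
    rw [Category.id_comp] at this
    change relEval τ P.obj n (holElem hD hτ P n f) p a = _
    rw [this]
    exact relEval_map τ n _ _ p a

theorem holDesc_univEval {Q : D.FullSubcategory}
    (Δ : ((relFunctor τ P.obj n).obj ((ofModule K A).obj Q.obj)).carrier) (p : P.obj) (a : ℕ → A) :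
    (holDesc hD hτ P n Δ).hom.hom (univEval hD hτ P (n + 1) p a) = relEval τ P.obj n Δ p a := by
  rw [← holEval_eq, ← holElem_holDesc hD hτ P n Δ, holDesc_holElem]
  rfl

variable {P n}

theorem hol_hom_ext_univEval {Q : D.FullSubcategory} {f g : Hol hD hτ P n ⟶ Q}
    (h : ∀ p a, f.hom.hom (univEval hD hτ P n p a) = g.hom.hom (univEval hD hτ P n p a)) :
    f = g := by
  cases n with
  | zero => exact ObjectProperty.hom_ext _ (ModuleCat.hom_ext (LinearMap.ext fun p => h p 0))
  | succ n =>
    rw [← holDesc_holElem hD hτ P n f, ← holDesc_holElem hD hτ P n g]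
    congr 1
    refine relEval_ext τ n fun p a => ?_
    have := h p a
    rw [← holEval_eq, ← holEval_eq] at this
    exact this

variable (P n)

/-- Stated separately so that the zero morphisms involved are those of the given abelian structure,
whichever other preadditive structure `C` may have. -/
theorem balanced_of_abelian (C : Type*) [Category* C] [Abelian C] : Balanced C := inferInstance

/-- The subcategory is balanced and closed under subobjects, so that the joint epimorphy of the
universal values makes them generators. -/
theorem span_univEval : Submodule.span A
    (Set.range fun x : P.obj × (ℕ → A) => univEval hD hτ P n x.1 x.2) = ⊤ := by
  set N := Submodule.span A
    (Set.range fun x : P.obj × (ℕ → A) => univEval hD hτ P n x.1 x.2) with hN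
  have := hD.subobjects
  let i' : ModuleCat.of A N ⟶ (Hol hD hτ P n).obj := ModuleCat.ofHom N.subtype
  have hi' : Mono i' := (ModuleCat.mono_iff_injective i').2 Subtype.val_injective
  let N' : D.FullSubcategory := ⟨ModuleCat.of A N, D.prop_of_mono i' (Hol hD hτ P n).property⟩
  let i : N' ⟶ Hol hD hτ P n := ObjectProperty.homMk i'
  have hm : Mono i := D.ι.mono_of_mono_map hi'
  have he : Epi i := ⟨fun f g hfg => hol_hom_ext_univEval hD hτ fun p a => by
    have hu : univEval hD hτ P n p a ∈ N := Submodule.subset_span ⟨(p, a), rfl⟩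
    exact congrArg (fun m : N' ⟶ _ => m.hom.hom ⟨_, hu⟩) hfg⟩
  obtain ⟨hab⟩ := hD.abelian
  have : Balanced D.FullSubcategory := balanced_of_abelian _
  have : IsIso i := isIso_of_mono_of_epi i
  have h1 : inv i ≫ i = 𝟙 _ := IsIso.inv_hom_id i
  rw [eq_top_iff]
  intro x _
  have hx : i'.hom ((inv i).hom.hom x) = x := congrArg (fun m => m.hom.hom x) h1
  rw [← hx]
  exact ((inv i).hom.hom x).2

/-- An additive map on `Hol^{τ(n)}[P]`, linear or not, is determined by its values on the
multiples of the universal values. -/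
theorem addHom_ext_univEval {M : Type*} [AddCommGroup M] {f g : (Hol hD hτ P n).obj →+ M}
    (h : ∀ (c : A) p a, f (c • univEval hD hτ P n p a) = g (c • univEval hD hτ P n p a)) : f = g := by
  ext x
  have hx : x ∈ Submodule.span A
      (Set.range fun x : P.obj × (ℕ → A) => univEval hD hτ P n x.1 x.2) := by
    rw [span_univEval]; trivial
  induction hx using Submodule.closure_induction with
  | zero => rw [map_zero, map_zero]
  | add x y _ _ hx hy => rw [map_add, map_add, hx, hy]
  | smul_mem c x hx => obtain ⟨⟨p, a⟩, rfl⟩ := hx; exact h c p a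

/-! ### The differential -/

/-- The `A`-linear map `f : Hol^{τ(n+1)}[P] → Diff⁺(A, Hol^{τ(n+2)}[P])` with `δ(h) = f(h)(1)`. -/
noncomputable def holJet : Hol hD hτ P (n + 1) ⟶
    diffPlusObj hD (τ (n + 1)) (Hol hD hτ P (n + 2)) :=
  holDesc hD hτ P n ((relFunctorPlusMap τ P.obj n (diffPlusId hD (τ (n + 1))
    (Hol hD hτ P (n + 2)))).map (holUniv hD hτ P (n + 1)))

/-- The operator `f(h) : A → Hol^{τ(n+2)}[P]`. -/
noncomputable def holJetApp (h : (Hol hD hτ P (n + 1)).obj) :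
    diffSub (τ (n + 1)) A ((ofModule K A).obj (Hol hD hτ P (n + 2)).obj) :=
  (holJet hD hτ P n).hom.hom h

theorem holJetApp_apply (h : (Hol hD hτ P (n + 1)).obj) (c : A) :
    (holJetApp hD hτ P n h).1 c = holDiff hD hτ P (n + 1) (c • h) := by
  change _ = (holJetApp hD hτ P n (c • h)).1 1
  have : holJetApp hD hτ P n (c • h) = c • holJetApp hD hτ P n h :=
    (holJet hD hτ P n).hom.hom.map_smul c h
  rw [this]
  change _ = (holJetApp hD hτ P n h).1 (c • (1 : A))
  rw [smul_eq_mul, mul_one]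

/-- The map `f` corresponds to the universal element of `P_{τ(n+2)}[P]`, so the operator
`f(u(p)(a₁)⋯(aₙ))` is the last layer of that element. -/
theorem holJetApp_univEval (p : P.obj) (a : ℕ → A) :
    holJetApp hD hτ P n (univEval hD hτ P (n + 1) p a) =
      relEval τ P.obj n (X := (absOne (τ (n + 1))).obj ((ofModule K A).obj
        (Hol hD hτ P (n + 2)).obj)) (holUniv hD hτ P (n + 1)) p a :=
  (holDesc_univEval hD hτ P n _ p a).trans (relEval_plusMap τ n _ _ p a)

/-- Each universal value is a differential: `u(p)(a₁)⋯(aₙ₊₁) = δ(aₙ₊₁ u(p)(a₁)⋯(aₙ))`. -/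
theorem univEval_succ_succ (p : P.obj) (a : ℕ → A) : univEval hD hτ P (n + 2) p a =
    holDiff hD hτ P (n + 1) (a n • univEval hD hτ P (n + 1) p a) := by
  rw [← holJetApp_apply]
  exact (DFunLike.congr_fun (congrArg Subtype.val (holJetApp_univEval hD hτ P n p a)) (a n)).symm

theorem univEval_one (p : P.obj) (a : ℕ → A) :
    univEval hD hτ P 1 p a = holDiff hD hτ P 0 p := rfl

/-- The last layers of the universal element lie in the selected submodule, hence annihilate `1`. -/
theorem holDiff_univEval (p : P.obj) (a : ℕ → A) :
    holDiff hD hτ P (n + 1) (univEval hD hτ P (n + 1) p a) = 0 := by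
  have h1 := relEval_mem_sub τ n
    (X := (absOne (τ (n + 1))).obj ((ofModule K A).obj (Hol hD hτ P (n + 2)).obj))
    (holUniv hD hτ P (n + 1)) p a
  rw [← holJetApp_univEval] at h1
  have h2 : (holJetApp hD hτ P n (univEval hD hτ P (n + 1) p a)).1 1 = 0 := h1
  rwa [holJetApp_apply, one_smul] at h2

/-- For `n ≥ 1` the elements `c u(p)(a₁)⋯(aₙ₋₁)` span `Hol^{τ(n)}[P]` additively, and their
differentials are universal values, which the next differential annihilates. -/
theorem holDiff_holDiff (h : (Hol hD hτ P n).obj) :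
    holDiff hD hτ P (n + 1) (holDiff hD hτ P n h) = 0 := by
  cases n with
  | zero => exact holDiff_univEval hD hτ P 0 h 0
  | succ n =>
    have : (holDiff hD hτ P (n + 2)).comp (holDiff hD hτ P (n + 1)) = 0 :=
      addHom_ext_univEval hD hτ P (n + 1) fun c p a => by
        have h1 := univEval_succ_succ hD hτ P n p (Function.update a n c)
        rw [Function.update_self, univEval_congr hD hτ P (n + 1) p (b := a)
          fun i hi => Function.update_of_ne (by omega) _ _] at h1
        rw [AddMonoidHom.comp_apply, ← h1]
        exact holDiff_univEval hD hτ P (n + 1) p _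
    exact DFunLike.congr_fun this h

theorem isDiffOp_holDiff : IsDiffOp K A (τ n) (holDiff hD hτ P n) := by
  cases n with
  | zero => exact (show diffSub (τ 0) P.obj ((ofModule K A).obj (Hol hD hτ P 1).obj) from
      holUniv hD hτ P 0).2.1
  | succ n =>
    have h1 : ∀ h c, (holJetApp hD hτ P n h).1 c = holDiff hD hτ P (n + 1) (c • h) :=
      holJetApp_apply hD hτ P n
    let E : (Hol hD hτ P (n + 1)).obj →+ (A →+ (Hol hD hτ P (n + 2)).obj) :=
      ⟨⟨fun h => (holJetApp hD hτ P n h).1, AddMonoidHom.ext fun c => by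
        rw [h1, smul_zero, map_zero]; rfl⟩, fun x y => AddMonoidHom.ext fun c => by
        change (holJetApp hD hτ P n (x + y)).1 c =
          (holJetApp hD hτ P n x).1 c + (holJetApp hD hτ P n y).1 c
        rw [h1, h1, h1, smul_add, map_add]
        rfl⟩
    refine ⟨fun c h => ?_, ?_⟩
    · rw [← h1]
      have h2 := (holJetApp hD hτ P n h).2.1.map_algebraMap c 1
      rw [smul_eq_mul, mul_one] at h2
      rw [h2, h1, one_smul]
      rfl
    · have h2 : holDiff hD hτ P (n + 1) = (AddMonoidHom.eval (1 : A)).comp E := by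
        ext h
        change _ = (holJetApp hD hτ P n h).1 1
        rw [h1, one_smul]
      rw [h2]
      refine HasOrderLE.eval_one (fun c h x => ?_) fun h => (holJetApp hD hτ P n h).2.1.2
      change (holJetApp hD hτ P n (c • h)).1 x = (holJetApp hD hτ P n h).1 (c * x)
      rw [h1, h1, smul_smul, mul_comm]

/-- The linear maps out of `Hol^{τ(n+1)}[P]` are determined by their composites with `δ`. -/
theorem hol_hom_ext {Q : D.FullSubcategory} {f g : Hol hD hτ P (n + 1) ⟶ Q}
    (h : ∀ x, f.hom.hom (holDiff hD hτ P n x) = g.hom.hom (holDiff hD hτ P n x)) : f = g :=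
  hol_hom_ext_univEval hD hτ fun p a => by
    cases n with
    | zero => exact h p
    | succ n => rw [univEval_succ_succ]; exact h _

/-! ### The universal property of the differential -/

/-- `δ : P → Hol^{τ(1)}[P]` is universal among the operators of order `≤ τ₁`. -/
theorem exists_factor_zero {Q : D.FullSubcategory} {Φ : P.obj →+ Q.obj}
    (hΦ : IsDiffOp K A (τ 0) Φ) :
    ∃ g : Hol hD hτ P 1 ⟶ Q, ∀ x, g.hom.hom (holDiff hD hτ P 0 x) = Φ x := by
  let Δ : diffSub (τ 0) P.obj ((ofModule K A).obj Q.obj) := ⟨Φ, hΦ, fun _ => trivial⟩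
  exact ⟨holDesc hD hτ P 0 Δ, fun x => holDesc_univEval hD hτ P 0 Δ x 0⟩

/-- `δ : Hol^{τ(n+1)}[P] → Hol^{τ(n+2)}[P]` is universal among the operators of order `≤ τₙ₊₂`
that vanish on the image of the preceding differential: such an operator `Φ` amounts to the linear
map `h ↦ (a ↦ Φ(a h))` into `Diff⁺(A, Q)`, and its vanishing says that the values of the
corresponding element of `P_{τ(n+1)}[P](Diff⁺(A, Q))` are operators that annihilate `1`. -/
theorem exists_factor_succ {Q : D.FullSubcategory} {Φ : (Hol hD hτ P (n + 1)).obj →+ Q.obj}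
    (hΦ : IsDiffOp K A (τ (n + 1)) Φ) (h0 : ∀ x, Φ (holDiff hD hτ P n x) = 0) :
    ∃ g : Hol hD hτ P (n + 2) ⟶ Q, ∀ x, g.hom.hom (holDiff hD hτ P (n + 1) x) = Φ x := by
  let E : (Hol hD hτ P (n + 1)).obj → diffSub (τ (n + 1)) A ((ofModule K A).obj Q.obj) := fun h =>
    ⟨Φ.comp (LinearMap.toSpanSingleton A _ h).toAddMonoidHom,
      hΦ.precomp (LinearMap.toSpanSingleton A _ h), fun _ => trivial⟩
  let f' : (Hol hD hτ P (n + 1)).obj →ₗ[A]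
      diffSub (τ (n + 1)) A ((ofModule K A).obj Q.obj) :=
    { toFun := E
      map_add' := fun x y => Subtype.ext (AddMonoidHom.ext fun c => by
        change Φ (c • (x + y)) = Φ (c • x) + Φ (c • y)
        rw [smul_add, map_add])
      map_smul' := fun b x => Subtype.ext (AddMonoidHom.ext fun c => by
        change Φ (c • b • x) = Φ ((b • c) • x)
        rw [smul_smul, smul_eq_mul, mul_comm]) }
  let f : Hol hD hτ P (n + 1) ⟶ diffPlusObj hD (τ (n + 1)) Q :=
    ObjectProperty.homMk (ModuleCat.ofHom f')
  have hu : ∀ p a, Φ (univEval hD hτ P (n + 1) p a) = 0 := fun p a => by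
    cases n with
    | zero => exact h0 p
    | succ n => rw [univEval_succ_succ]; exact h0 _
  obtain ⟨Δ, hΔ⟩ := exists_relFunctorPlusMap_eq τ n (f := diffPlusId hD (τ (n + 1)) Q)
    (fun _ _ h => h) (holElem hD hτ P n f) fun p a => by
      refine ⟨E (univEval hD hτ P (n + 1) p a), ?_, (holEval_eq hD hτ P (n + 1) f p a).symm⟩
      change Φ ((1 : A) • _) = 0
      rw [one_smul, hu]
  refine ⟨holDesc hD hτ P (n + 1) Δ, fun x => ?_⟩
  let g : Hol hD hτ P (n + 2) ⟶ Q := holDesc hD hτ P (n + 1) Δ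
  let G : diffPlusObj hD (τ (n + 1)) (Hol hD hτ P (n + 2)) ⟶ diffPlusObj hD (τ (n + 1)) Q :=
    ObjectProperty.homMk (ModuleCat.ofHom
      (BiadHom.map ((absOne (τ (n + 1))).map ((ofModule K A).map g.hom))))
  -- `Δ` is the image of the universal element under `g`, so that `holJet ≫ G` and `f` correspond to
  -- the same element of `P_{τ(n+1)}[P](Diff⁺(A, Q))`; evaluating at `1` gives `g ∘ δ = Φ`.
  have key : holJet hD hτ P n ≫ G = f := by
    refine hol_hom_ext_univEval hD hτ fun p a => ?_
    have h1 := holEval_eq hD hτ P (n + 1) f p a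
    change relEval τ P.obj n (holElem hD hτ P n f) p a = _ at h1
    rw [← hΔ, relEval_plusMap] at h1
    have h2 : Δ = BiadHom.map ((relFunctor τ P.obj (n + 1)).map ((ofModule K A).map g.hom))
        (holUniv hD hτ P (n + 1)) := by
      refine (holElem_holDesc hD hτ P (n + 1) Δ).symm.trans (.trans ?_
        (holElem_comp hD hτ P (n + 1) (𝟙 _) g))
      rw [Category.id_comp]
    refine Eq.trans ?_ h1
    rw [h2]
    exact (congrArg (BiadHom.map ((absOne (τ (n + 1))).map ((ofModule K A).map g.hom)))
      (holJetApp_univEval hD hτ P n p a)).trans (relEval_map τ n _ _ p a).symm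
  have h5 := congrArg (fun m : Hol hD hτ P (n + 1) ⟶ diffPlusObj hD (τ (n + 1)) Q =>
    (show diffSub (τ (n + 1)) A ((ofModule K A).obj Q.obj) from m.hom.hom x).1 1) key
  change g.hom.hom ((holJetApp hD hτ P n x).1 1) = Φ ((1 : A) • x) at h5
  rw [one_smul, holJetApp_apply, one_smul] at h5
  exact h5

/-! ### The contracting homotopy -/

open Classical in
/-- The linear map `g : Hol^{τ(n+1)}[P] → Q` with `g ∘ δ = Φ`, and `0` if there is none. -/
noncomputable def holFactor {Q : D.FullSubcategory} (Φ : (Hol hD hτ P n).obj →+ Q.obj) :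
    Hol hD hτ P (n + 1) ⟶ Q :=
  if h : ∃ g : Hol hD hτ P (n + 1) ⟶ Q, ∀ x, g.hom.hom (holDiff hD hτ P n x) = Φ x
  then h.choose else 0

theorem holFactor_holDiff {Q : D.FullSubcategory} {Φ : (Hol hD hτ P n).obj →+ Q.obj}
    (h : ∃ g : Hol hD hτ P (n + 1) ⟶ Q, ∀ x, g.hom.hom (holDiff hD hτ P n x) = Φ x)
    (x : (Hol hD hτ P n).obj) : (holFactor hD hτ P n Φ).hom.hom (holDiff hD hτ P n x) = Φ x := by
  rw [holFactor, dif_pos h]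
  exact h.choose_spec x

/-- The contracting homotopy. The linear map `φ^{τ(n+1)}` is the factorization through
`δ_{τ(n+1)}` of `id - δ_{τ(n)} ∘ φ^{τ(n)}`, or of `id` if `n = 0`. -/
noncomputable def holHomotopy : ∀ n : ℕ, Hol hD hτ P (n + 1) ⟶ Hol hD hτ P n
  | 0 => holFactor hD hτ P 0 (AddMonoidHom.id _)
  | n + 1 => holFactor hD hτ P (n + 1) (AddMonoidHom.id _ -
      (holDiff hD hτ P n).comp (holHomotopy n).hom.hom.toAddMonoidHom)

theorem holHomotopy_zero (x : P.obj) :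
    (holHomotopy hD hτ P 0).hom.hom (holDiff hD hτ P 0 x) = x :=
  holFactor_holDiff hD hτ P 0 (exists_factor_zero hD hτ P
    (isDiffOp_of_linearMap (LinearMap.id : P.obj →ₗ[A] P.obj) _)) x

/-- The operator `id - δ_{τ(n+1)} ∘ φ^{τ(n+1)}` has order `≤ τₙ₊₁ ≤ τₙ₊₂`, by regularity, and
vanishes on the image of `δ_{τ(n+1)}`, by the homotopy identity one degree lower. -/
theorem holHomotopy_succ (hmono : Monotone τ) : ∀ (n : ℕ) (x : (Hol hD hτ P (n + 1)).obj),
    (holHomotopy hD hτ P (n + 1)).hom.hom (holDiff hD hτ P (n + 1) x) =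
      x - holDiff hD hτ P n ((holHomotopy hD hτ P n).hom.hom x) := by
  have step : ∀ n, (∀ x, holDiff hD hτ P n ((holHomotopy hD hτ P n).hom.hom
      (holDiff hD hτ P n x)) = holDiff hD hτ P n x) →
      ∀ (x : (Hol hD hτ P (n + 1)).obj),
    (holHomotopy hD hτ P (n + 1)).hom.hom (holDiff hD hτ P (n + 1) x) =
      x - holDiff hD hτ P n ((holHomotopy hD hτ P n).hom.hom x) := by
    intro n hn
    refine holFactor_holDiff hD hτ P (n + 1) (exists_factor_succ hD hτ P n ?_ fun x => ?_)
    · rw [sub_eq_add_neg]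
      exact (isDiffOp_of_linearMap (LinearMap.id : (Hol hD hτ P (n + 1)).obj →ₗ[A] _) _).add
        (((isDiffOp_holDiff hD hτ P n).mono (hmono n.le_succ)).precomp _).neg
    · exact sub_eq_zero.2 (hn x).symm
  intro n
  induction n with
  | zero => exact step 0 fun x => congrArg (holDiff hD hτ P 0) (holHomotopy_zero hD hτ P x)
  | succ n ih => exact step (n + 1) fun x => by rw [ih, map_sub, holDiff_holDiff, sub_zero]

theorem map_homotopyFormula {P Q R : ModuleCat.{u} A} (f : Q →ₗ[A] R) (n : ℕ)
    (F : P → (ℕ → A) → Q) (p : P) (a : ℕ → A) :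
    f (homotopyFormula n F p a) = homotopyFormula n (fun p a => f (F p a)) p a := by
  cases n with
  | zero => rfl
  | succ n => simp only [homotopyFormula, map_add, map_sum, map_zsmul, map_smul]

/-- The homotopy has the explicit form required of it, since on generators
`φ(δ(aₙ u)) = aₙ u - δ(aₙ φ(u))`, and `δ(b u(p)(a₁)⋯)` is a universal value with last argument `b`. -/
theorem holHomotopy_univEval (hmono : Monotone τ) (p : P.obj) (a : ℕ → A) :
    (holHomotopy hD hτ P n).hom.hom (univEval hD hτ P (n + 1) p a) =
      homotopyFormula n (univEval hD hτ P n) p a := by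
  induction n with
  | zero => exact holHomotopy_zero hD hτ P p
  | succ n ih =>
    rw [univEval_succ_succ, holHomotopy_succ hD hτ P hmono, map_smul, ih]
    cases n with
    | zero =>
      simp only [homotopyFormula, univEval_zero]
      simp [sub_eq_add_neg, univEval_one]
      rfl
    | succ m =>
      have hδ : ∀ (c : A) (p : P.obj) (b : ℕ → A) (b' : ℕ → A), (∀ i < m, b i = b' i) →
          b' m = c → holDiff hD hτ P (m + 1) (c • univEval hD hτ P (m + 1) p b) =
            univEval hD hτ P (m + 2) p b' := by
        intro c p b b' hb hc
        rw [univEval_succ_succ, hc, univEval_congr hD hτ P (m + 1) p (b := b')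
          fun i hi => hb i (by omega)]
      -- Applied to `aₘ₊₂` times the formula one degree lower, `δ` turns the leading term into the
      -- contraction of the last two arguments and appends `aₘ₊₂` to the other terms.
      have e1 := hδ (a (m + 1) * a m) p a (contract m a) (fun i hi => by simp [contract, hi])
        (by simp [contract, mul_comm])
      have e2 : ∀ k ∈ Finset.range m, holDiff hD hτ P (m + 1)
          (a (m + 1) • univEval hD hτ P (m + 1) p (contract k a)) =
            univEval hD hτ P (m + 2) p (contract k a) := fun k hk => by
        have := Finset.mem_range.1 hk
        exact hδ _ p _ _ (fun _ _ => rfl) (by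
          rw [contract, if_neg (by omega), if_neg (by omega)])
      have e3 := hδ (a (m + 1)) (a 0 • p) (fun i => a (i + 1)) (fun i => a (i + 1))
        (fun _ _ => rfl) rfl
      have e4 : ∑ k ∈ Finset.range m, (-1 : ℤ) ^ (m + 1 - k) •
            univEval hD hτ P (m + 2) p (contract k a) =
          -∑ k ∈ Finset.range m, (-1 : ℤ) ^ (m - k) •
            univEval hD hτ P (m + 2) p (contract k a) := by
        rw [← Finset.sum_neg_distrib]
        refine Finset.sum_congr rfl fun k hk => ?_
        have := Finset.mem_range.1 hk
        rw [show m + 1 - k = (m - k) + 1 by omega, pow_succ, mul_neg_one, neg_smul]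
      simp only [homotopyFormula]
      rw [Finset.sum_range_succ, e4, smul_add, smul_add, Finset.smul_sum, map_add, map_add,
        map_sum, smul_smul, e1, smul_comm (a (m + 1)) ((-1 : ℤ) ^ (m + 1)), map_zsmul, e3,
        Finset.sum_congr rfl fun k hk => by rw [smul_comm, map_zsmul, e2 k hk],
        show m + 1 - m = 1 by omega, pow_succ (-1 : ℤ) (m + 1), pow_one, mul_neg_one, neg_smul,
        neg_smul, one_smul]
      abel

/-! ### Naturality and uniqueness -/

variable {P} in
theorem holMap_univEval {P' : D.FullSubcategory} (g : P ⟶ P') (p : P.obj) (a : ℕ → A) :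
    (holMap hD hτ g n).hom.hom (univEval hD hτ P n p a) =
      univEval hD hτ P' n (g.hom.hom p) a := by
  cases n with
  | zero => rfl
  | succ n =>
    rw [← holEval_eq]
    change relEval τ P.obj n (holElem hD hτ P n (holDesc hD hτ P n _)) p a = _
    rw [holElem_holDesc]
    rfl

variable {P} in
theorem holDiff_holMap {P' : D.FullSubcategory} (g : P ⟶ P') (x : (Hol hD hτ P n).obj) :
    holDiff hD hτ P' n ((holMap hD hτ g n).hom.hom x) =
      (holMap hD hτ g (n + 1)).hom.hom (holDiff hD hτ P n x) := by
  cases n with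
  | zero => exact (holMap_univEval hD hτ 1 g x 0).symm
  | succ n =>
    refine DFunLike.congr_fun (f := (holDiff hD hτ P' (n + 1)).comp
      (holMap hD hτ g (n + 1)).hom.hom.toAddMonoidHom)
      (g := (holMap hD hτ g (n + 2)).hom.hom.toAddMonoidHom.comp (holDiff hD hτ P (n + 1)))
      (addHom_ext_univEval hD hτ P (n + 1) fun c p a => ?_) x
    have hc : ∀ (P : D.FullSubcategory) (p : P.obj), holDiff hD hτ P (n + 1)
        (c • univEval hD hτ P (n + 1) p a) =
          univEval hD hτ P (n + 2) p (Function.update a n c) := fun P p => by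
      rw [univEval_succ_succ, Function.update_self,
        univEval_congr hD hτ P (n + 1) p (a := Function.update a n c) (b := a)
          fun i hi => Function.update_of_ne (by omega) _ _]
    change holDiff hD hτ P' (n + 1) ((holMap hD hτ g (n + 1)).hom.hom (c • _)) =
      (holMap hD hτ g (n + 2)).hom.hom (holDiff hD hτ P (n + 1) _)
    rw [map_smul, holMap_univEval, hc, hc, holMap_univEval]

variable {P} in
theorem holHomotopy_comp_holMap (hmono : Monotone τ) {P' : D.FullSubcategory} (g : P ⟶ P') :
    holHomotopy hD hτ P n ≫ holMap hD hτ g n =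
      holMap hD hτ g (n + 1) ≫ holHomotopy hD hτ P' n := by
  induction n with
  | zero =>
    refine hol_hom_ext hD hτ P 0 fun x => ?_
    change (holMap hD hτ g 0).hom.hom ((holHomotopy hD hτ P 0).hom.hom _) =
      (holHomotopy hD hτ P' 0).hom.hom ((holMap hD hτ g 1).hom.hom _)
    rw [← holDiff_holMap]
    exact (congrArg g.hom.hom (holHomotopy_zero hD hτ P x)).trans
      (holHomotopy_zero hD hτ P' _).symm
  | succ n ih =>
    refine hol_hom_ext hD hτ P (n + 1) fun x => ?_
    have hx : (holMap hD hτ g n).hom.hom ((holHomotopy hD hτ P n).hom.hom x) =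
        (holHomotopy hD hτ P' n).hom.hom ((holMap hD hτ g (n + 1)).hom.hom x) :=
      congrArg (fun m => m.hom.hom x) ih
    change (holMap hD hτ g (n + 1)).hom.hom ((holHomotopy hD hτ P (n + 1)).hom.hom _) =
      (holHomotopy hD hτ P' (n + 1)).hom.hom ((holMap hD hτ g (n + 2)).hom.hom _)
    rw [holHomotopy_succ hD hτ P hmono, ← holDiff_holMap, holHomotopy_succ hD hτ P' hmono,
      map_sub, ← holDiff_holMap, hx]

theorem isDualHomotopy_iff (hmono : Monotone τ) (ψ : Hol hD hτ P (n + 1) ⟶ Hol hD hτ P n) :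
    IsDualHomotopy hD hτ P n ψ ↔ ψ = holHomotopy hD hτ P n := by
  constructor
  · intro h
    refine hol_hom_ext_univEval hD hτ fun p a => ?_
    have := h _ (𝟙 _) p a
    rw [Category.comp_id, holEval_eq] at this
    rw [this, holHomotopy_univEval hD hτ P n hmono]
    rfl
  · rintro rfl Q f p a
    rw [holEval_eq]
    change f.hom.hom ((holHomotopy hD hτ P n).hom.hom _) = _
    rw [holHomotopy_univEval hD hτ P n hmono, map_homotopyFormula]
    congr 1
    funext p a
    exact (holEval_eq hD hτ P n f p a).symm

end Hol

end HigherDiff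

theorem mainTheorem6 {K : Type v} {A : Type u} [CommRing K] [CommRing A] [Algebra K A]
    (D : ObjectProperty (ModuleCat.{u} A)) (hD : IsDifferentiallyClosed K D)
    (_hsmooth : IsSmooth K D) (τ : ℕ → ℕ) (hτ : ∀ i, 0 < τ i) (_hregular : Monotone τ) :
    ∃ φ : ∀ (P : D.FullSubcategory) (n : ℕ), Hol hD hτ P (n + 1) ⟶ Hol hD hτ P n,
      -- `φ P n` is the one and only dual representative of the explicit map of functors
      (∀ P n ψ, IsDualHomotopy hD hτ P n ψ ↔ ψ = φ P n) ∧
      -- the differentials form a complex of differential operators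
      (∀ P n, IsDiffOp K A (τ n) (holDiff hD hτ P n)) ∧
      (∀ P n h, holDiff hD hτ P (n + 1) (holDiff hD hτ P n h) = 0) ∧
      -- `φ` is a contracting homotopy
      (∀ P h, (φ P 0).hom.hom (holDiff hD hτ P 0 h) = h) ∧
      (∀ P n h, (φ P (n + 1)).hom.hom (holDiff hD hτ P (n + 1) h) +
        holDiff hD hτ P n ((φ P n).hom.hom h) = h) ∧
      -- naturality in `P`, of the complex and of the homotopy
      (∀ (P P' : D.FullSubcategory) (g : P ⟶ P') n h,
        holDiff hD hτ P' n ((holMap hD hτ g n).hom.hom h) =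
          (holMap hD hτ g (n + 1)).hom.hom (holDiff hD hτ P n h)) ∧
      (∀ (P P' : D.FullSubcategory) (g : P ⟶ P') n,
        φ P n ≫ holMap hD hτ g n = holMap hD hτ g (n + 1) ≫ φ P' n) ∧
      -- acyclicity
      (∀ P, Function.Injective (holDiff hD hτ P 0)) ∧
      (∀ P n h, holDiff hD hτ P (n + 1) h = 0 → ∃ h', holDiff hD hτ P n h' = h) := by
  have succ := fun P n h => sub_eq_iff_eq_add.1 (holHomotopy_succ hD hτ P _hregular n h).symm
  refine ⟨holHomotopy hD hτ, fun P n ψ => isDualHomotopy_iff hD hτ P n _hregular ψ,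
    isDiffOp_holDiff hD hτ, holDiff_holDiff hD hτ, holHomotopy_zero hD hτ,
    fun P n h => (succ P n h).symm, fun P P' g n h => holDiff_holMap hD hτ n g h,
    fun P P' g n => holHomotopy_comp_holMap hD hτ n _hregular g,
    fun P => Function.LeftInverse.injective (holHomotopy_zero hD hτ P), fun P n h h0 => ?_⟩
  refine ⟨(holHomotopy hD hτ P n).hom.hom h, ?_⟩
  have := succ P n h
  rw [h0, map_zero, zero_add] at this
  exact this.symm
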